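/- Let $W$ be a discrete memoryless channel with finite input alphabet $\mathcal X$ (for instance $|\mathcal X|=2$), finite output alphabet $\mathcal Y$ and capacity $C=\max_{P_X} I(X;Y)>0$ (all logarithms are to base 2), and fix $K\ge 1$. A $K$-RMOID (ranked-multiple-object identification) code of length $n$ for $N$ receivers consists of an encoder $\tilde\varphi$ that maps a ranking $\boldsymbol K=(i_1,\dots,i_K)$ of $K$ distinct receivers $i_j\in\{1,\dots,N\}$ and a random number $v\in\mathcal V$ to a word in $\mathcal X^n$, and of decoders $\tilde\psi_i:\mathcal Y^n\to\{1,\dots,K,\mathrm F\}$, $1\le i\le N$. Here $\mathrm F$ (outside of the ranking) is treated as rank $K+1$. Its rate is $R^{(n)}=\frac1n\log\log N$. Let $V$ be uniform on $\mathcal V$ and let $\tilde\varphi(\boldsymbol K,V)$ be sent through $W$; $\tilde\lambda_1^{(n)}$ (resp. $\tilde\lambda_2^{(n)}$) is the maximum, over all rankings $\boldsymbol K$ and all receivers $i$, of the probability that the rank decoded by receiver $i$ is larger (resp. smaller) than its true rank. Coding Scheme 2 uses an $\varepsilon$-almost strongly universal class of hash functions $h_v:\{1,\dots,N\}\to\mathcal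 B$, $v\in\mathcal V$: $|\{v: h_v(a)=b\}|=|\mathcal V|/|\mathcal B|$ for all $a,b$, and $|\{v: h_v(a_1)=b_1,\ h_v(a_2)=b_2\}|\le\varepsilon|\mathcal V|/|\mathcal B|$ for all $a_1\ne a_2$ and all $b_1,b_2$. Its parameters are those of the Kurosawa–Yoshida class: $q=2^m$, $N=q^{kq^t}$, $|\mathcal B|=q$, $|\mathcal V|=q^{k+2}$, $\varepsilon=\frac kq+\frac{q^t-1}{q^k}$, with $m,k\ge1$ and $t=k-1$. It also uses a transmission code $f:\mathcal V\times\mathcal B^K\to\mathcal X^n$, $g:\mathcal Y^n\to\mathcal V\times\mathcal B^K$. The encoder is $$\tilde\varphi(\boldsymbol K,v)=f(v,h_v(i_1),\dots,h_v(i_K)),$$ and, with $(\hat v,\beta_1,\dots,\beta_K)=g(y^n)$, $\tilde\psi_i(y^n)$ is the smallest $j$ such that $h_{\hat v}(i)=\beta_j$, or $\mathrm F$ if there is no such $j$. Then the hash classes and the transmission codes can be chosen, for every block length $n$, so that the $K$-RMOID codes constructed by Coding Scheme 2 attain $$\lim_{n\to\infty}R^{(n)}=C,\qquad \lim_{n\to\infty}\tilde\lambda_1^{(n)}=0,\qquad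 \lim_{n\to\infty}\tilde\lambda_2^{(n)}=0 .$$ -/

import Mathlib

noncomputable section

/-- A discrete memoryless channel with finite input alphabet `X` and finite output alphabet `Y`:
`W x` is the output distribution for the input letter `x`, so `(W x).1 y = W(y | x)`. -/
abbrev DMC (X Y : Type*) [Fintype Y] : Type _ := X → stdSimplex ℝ Y

/-- The probability `W^n(y^n | x^n)` of the output word `y` when `x` is sent through `n` independent
uses of the channel. -/
def DMC.wordProb {X Y : Type*} [Fintype Y] (W : DMC X Y) {n : ℕ} (x : Fin n → X) (y : Fin n → Y) :
    ℝ :=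
  ∏ s, (W (x s)).1 (y s)

/-- The mutual information `I(X; Y)` in bits, for input distribution `P` and channel `W`.
Terms of probability zero contribute zero. -/
def DMC.mutualInfo {X Y : Type*} [Fintype X] [Fintype Y] (W : DMC X Y) (P : stdSimplex ℝ X) : ℝ :=
  ∑ x, ∑ y, P.1 x * (W x).1 y * Real.logb 2 ((W x).1 y / ∑ x', P.1 x' * (W x').1 y)

/-- The channel capacity `C = max_P I(X; Y)`, in bits. -/
def DMC.capacity {X Y : Type*} [Fintype X] [Fintype Y] (W : DMC X Y) : ℝ :=
  ⨆ P : stdSimplex ℝ X, W.mutualInfo P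

open Classical in
/-- The position of the first entry of `β` that equals `b`; if there is none, the extra value
`Fin.last K`. Ranks `1, …, K` are represented by `0, …, K - 1`, and `F` (outside of the ranking,
treated as rank `K + 1`) by `Fin.last K`. -/
def firstRank {B : Type*} {K : ℕ} (b : B) (β : Fin K → B) : Fin (K + 1) :=
  if h : ∃ j, β j = b then (Fin.find (fun j => β j = b) h).castSucc else Fin.last K

/-- A `K`-RMOID (ranked-multiple-object identification) code of length `n` for `N` receivers whose
encoder uses a random number from a set of `M` elements. The ranked receivers `(i₁, …, i_K)` are
given as an injective tuple. -/
structure RMOIDCode (X Y : Type*) (K n N M : ℕ) where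
  /-- The encoder. -/
  enc : (Fin K ↪ Fin N) → Fin M → (Fin n → X)
  /-- The decoders of the `N` receivers, with outputs in `{1, …, K, F}`. -/
  dec : Fin N → (Fin n → Y) → Fin (K + 1)

namespace RMOIDCode

variable {X Y : Type*} [Fintype Y] {K n N M : ℕ}

open Classical in
/-- The probability that the rank decoded by receiver `i` satisfies `p`, when the ranking `κ` is
encoded with a uniformly distributed random number and the codeword is sent through `W`. -/
def decProb (c : RMOIDCode X Y K n N M) (W : DMC X Y) (κ : Fin K ↪ Fin N) (i : Fin N)
    (p : Fin (K + 1) → Prop) : ℝ :=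
  ∑ v : Fin M, (1 / (M : ℝ)) *
    ∑ y : Fin n → Y, if p (c.dec i y) then W.wordProb (c.enc κ v) y else 0

/-- The worst probability of a type I error: the decoded rank of a receiver is larger than its true
rank. -/
def typeI (c : RMOIDCode X Y K n N M) (W : DMC X Y) : ℝ :=
  ⨆ κ : Fin K ↪ Fin N, ⨆ i : Fin N, c.decProb W κ i (fun j => firstRank i κ < j)

/-- The worst probability of a type II error: the decoded rank of a receiver is smaller than its
true rank. -/
def typeII (c : RMOIDCode X Y K n N M) (W : DMC X Y) : ℝ :=
  ⨆ κ : Fin K ↪ Fin N, ⨆ i : Fin N, c.decProb W κ i (fun j => j < firstRank i κ)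

/-- The coding rate `(1 / n) log log N`, with logarithms to base 2. -/
def rate (_c : RMOIDCode X Y K n N M) : ℝ :=
  (1 / (n : ℝ)) * Real.logb 2 (Real.logb 2 (N : ℝ))

end RMOIDCode

open Classical in
/-- `h` is an `ε`-almost strongly universal class of hash functions `h v : A → B`, indexed by
`v : V`. -/
def IsAlmostStronglyUniversal {V A B : Type*} [Fintype V] [Fintype B] (h : V → A → B) (ε : ℝ) :
    Prop :=
  (∀ (a : A) (b : B),
    (Fintype.card {v : V // h v a = b} : ℝ) = (Fintype.card V : ℝ) / (Fintype.card B : ℝ)) ∧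
  ∀ (a₁ a₂ : A), a₁ ≠ a₂ → ∀ (b₁ b₂ : B),
    (Fintype.card {v : V // h v a₁ = b₁ ∧ h v a₂ = b₂} : ℝ)
      ≤ ε * ((Fintype.card V : ℝ) / (Fintype.card B : ℝ))

/-- The data from which the hash-based coding scheme for `K` ranked receivers builds a code of
length `n`: a class of hash functions with the parameters of the Kurosawa–Yoshida class,
and a transmission code for the channel. -/
structure RankedScheme (X Y : Type*) (K n : ℕ) where
  /-- The parameter `m` in `q = 2 ^ m`. -/
  m : ℕ
  hm : 1 ≤ m
  /-- The parameter `k` of the hash class. -/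
  k : ℕ
  /-- The parameter `t` of the hash class, chosen as `k - 1`. -/
  t : ℕ
  ht : t + 1 = k
  /-- The hash functions `h_v : {1, …, N} → B`, with `N = q ^ (k q ^ t)`, `|B| = q` and
  `|V| = q ^ (k + 2)`. -/
  hash : Fin ((2 ^ m) ^ (k + 2)) → Fin ((2 ^ m) ^ (k * (2 ^ m) ^ t)) → Fin (2 ^ m)
  hash_universal : IsAlmostStronglyUniversal hash
    ((k : ℝ) / 2 ^ m + ((2 ^ m : ℝ) ^ t - 1) / (2 ^ m : ℝ) ^ k)
  /-- The encoder of the transmission code. -/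
  f : Fin ((2 ^ m) ^ (k + 2)) × (Fin K → Fin (2 ^ m)) → (Fin n → X)
  /-- The decoder of the transmission code. -/
  g : (Fin n → Y) → Fin ((2 ^ m) ^ (k + 2)) × (Fin K → Fin (2 ^ m))

namespace RankedScheme

variable {X Y : Type*} {K n : ℕ}

/-- The `K`-RMOID code built by the scheme. The encoder sends
`f (v, h_v(i₁), …, h_v(i_K))`; receiver `i` computes `(v̂, β₁, …, β_K) = g(y)` and outputs the first
`j` with `h_v̂(i) = β_j`, or `F` if there is none. -/
def code (S : RankedScheme X Y K n) :
    RMOIDCode X Y K n ((2 ^ S.m) ^ (S.k * (2 ^ S.m) ^ S.t)) ((2 ^ S.m) ^ (S.k + 2)) where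
  enc κ v := S.f (v, fun j => S.hash v (κ j))
  dec i y := firstRank (S.hash (S.g y).1 i) (S.g y).2

end RankedScheme

end

/-! Fix `γ < C`, take `m = ⌊√n⌋` and choose the largest `t` for which the `2 ^ (m (t + 3 + K))`
messages (key and `K` hash values) number at most `2 ^ (n γ)`. The channel coding theorem then
transmits them with small maximal error. Since `log log N = log (m k) + m t` and `m t = n γ - O(m)`,
the rate tends to `γ`: almost the whole message is key, and the number of receivers is doubly
exponential in its length.

Errors have two sources. When transmission succeeds, a ranked receiver matches at its own position,
so its decoded rank is never too large; it is too small only if a different ranked receiver has the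
same hash value. A union bound gives probability at most `K ε` for this, and `ε ≤ (n γ + 1) / 2 ^
√n` tends to zero.

The hash class is a concatenation of two polynomial evaluations with a one-time pad. The coding
theorem follows from Feinstein's greedy construction and a Chernoff bound on the information
density. Finally, schemes that are good for each fixed tolerance and all large `n` are merged into
one sequence. -/

/-! ### Almost strongly universal hashing by polynomial evaluation -/

theorem card_zeros_ofFn_le {L : Type*} [Field L] [Fintype L] [DecidableEq L] {T : ℕ}
    {a : Fin T → L} (ha : a ≠ 0) :
    (Finset.univ.filter fun z => (Polynomial.ofFn T a).eval z = 0).card ≤ T - 1 := by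
  have hT : 1 ≤ T := by
    rcases Nat.eq_zero_or_pos T with rfl | h
    · exact absurd (Subsingleton.elim a 0) ha
    · exact h
  have hp : Polynomial.ofFn T a ≠ 0 := by
    intro h
    apply ha
    ext i
    have := Polynomial.ofFn_coeff_eq_val_of_lt a i.2
    rw [h] at this
    simpa using this.symm
  have hd := Polynomial.ofFn_natDegree_lt hT a
  calc (Finset.univ.filter fun z => (Polynomial.ofFn T a).eval z = 0).card
      ≤ (Polynomial.ofFn T a).roots.toFinset.card := by
        apply Finset.card_le_card
        intro z hz
        simpa [hp] using hz
    _ ≤ (Polynomial.ofFn T a).roots.card := Multiset.toFinset_card_le _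
    _ ≤ (Polynomial.ofFn T a).natDegree := Polynomial.card_roots' _
    _ ≤ T - 1 := by omega

theorem card_eval_X_mul_ofFn_eq_le {F : Type*} [Field F] [Fintype F] [DecidableEq F] {k : ℕ}
    {c : Fin k → F} (hc : c ≠ 0) (d : F) :
    (Finset.univ.filter fun x => x * (Polynomial.ofFn k c).eval x = d).card ≤ k := by
  have hk : 1 ≤ k := by
    rcases Nat.eq_zero_or_pos k with rfl | h
    · exact absurd (Subsingleton.elim c 0) hc
    · exact h
  set p : Polynomial F := Polynomial.X * Polynomial.ofFn k c - Polynomial.C d with hpdef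
  have hp : p ≠ 0 := by
    intro h
    apply hc
    ext i
    -- The factor `X` shifts `c` to positive degrees, where the constant `d` cannot cancel it.
    have h1 : p.coeff (i + 1) = 0 := by rw [h]; simp
    rw [hpdef, Polynomial.coeff_sub, Polynomial.coeff_X_mul,
      Polynomial.ofFn_coeff_eq_val_of_lt c i.2, Polynomial.coeff_C_succ] at h1
    simpa using h1
  have hd : p.natDegree ≤ k := by
    have hlt := Polynomial.ofFn_natDegree_lt hk c
    rw [hpdef, Polynomial.natDegree_sub_C]
    refine Polynomial.natDegree_mul_le.trans ?_
    rw [Polynomial.natDegree_X]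
    omega
  calc (Finset.univ.filter fun x => x * (Polynomial.ofFn k c).eval x = d).card
      ≤ p.roots.toFinset.card := by
        apply Finset.card_le_card
        intro z hz
        have : p.eval z = 0 := by simp [hpdef, (Finset.mem_filter.1 hz).2]
        simpa [hp] using this
    _ ≤ p.roots.card := Multiset.toFinset_card_le _
    _ ≤ p.natDegree := Polynomial.card_roots' _
    _ ≤ k := hd

open Classical in
/-- The hash function with key `(z, x, y)`: the word `a` is evaluated as a polynomial at `z`, and
the coordinates `c` of the result give the value `y + c₀ x + c₁ x² + ⋯`. -/
noncomputable def polyHash {F L : Type*} [Field F] [Field L] {k T : ℕ}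
    (e : L → Fin k → F) (v : L × F × F) (a : Fin T → L) : F :=
  v.2.2 + v.2.1 * (Polynomial.ofFn k (e ((Polynomial.ofFn T a).eval v.1))).eval v.2.1

/-- The pad `y` makes each value uniform and cancels from the difference of two hashes. Distinct
words agree at no more than `T - 1` points `z`; at any other `z`, injectivity of `e` leaves a
nonzero polynomial condition on `x` with at most `k` solutions. -/
theorem polyHash_universal {F L : Type*} [Field F] [Field L] [Fintype F] [Fintype L] {k T : ℕ}
    (hT : 1 ≤ T) {e : L → Fin k → F} (he : Function.Injective e) :
    IsAlmostStronglyUniversal (polyHash (T := T) e)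
      ((k : ℝ) / Fintype.card F + ((T : ℝ) - 1) / Fintype.card L) := by
  classical
  have hF : (Fintype.card F : ℝ) ≠ 0 := by exact_mod_cast Fintype.card_ne_zero
  have hL : (Fintype.card L : ℝ) ≠ 0 := by exact_mod_cast Fintype.card_ne_zero
  have hV : (Fintype.card (L × F × F) : ℝ) / Fintype.card F
      = Fintype.card L * Fintype.card F := by
    rw [Fintype.card_prod, Fintype.card_prod]
    push_cast
    field_simp
  refine ⟨fun a b => ?_, fun a₁ a₂ ha b₁ b₂ => ?_⟩
  · rw [hV]
    have : Fintype.card {v : L × F × F // polyHash e v a = b} = Fintype.card (L × F) := by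
      refine Fintype.card_congr
        { toFun := fun v => (v.1.1, v.1.2.1)
          invFun := fun u => ⟨(u.1, u.2, b - polyHash e (u.1, u.2, 0) a), ?_⟩
          left_inv := ?_
          right_inv := fun u => rfl }
      · simp [polyHash]
      · rintro ⟨⟨z, x, y⟩, rfl⟩
        simp [polyHash]
    rw [Fintype.card_congr' (by congr!), this, Fintype.card_prod]
    push_cast
    rfl
  · rw [hV]
    set r : L → F → F := fun z x =>
      x * (Polynomial.ofFn k (e ((Polynomial.ofFn T a₁).eval z)
        - e ((Polynomial.ofFn T a₂).eval z))).eval x with hr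
    have h1 : Fintype.card {v : L × F × F // polyHash e v a₁ = b₁ ∧ polyHash e v a₂ = b₂}
        ≤ ∑ z : L, (Finset.univ.filter fun x => r z x = b₁ - b₂).card := by
      -- Once `z` and `x` are fixed, the value `b₁` determines `y`, so counting pairs `(z, x)`
      -- suffices.
      rw [← Finset.card_sigma, ← Fintype.card_coe]
      refine Fintype.card_le_of_injective
        (fun v => ⟨⟨v.1.1, v.1.2.1⟩, ?_⟩) ?_
      · obtain ⟨⟨z, x, y⟩, h1, h2⟩ := v
        simp only [Finset.mem_sigma, Finset.mem_univ, Finset.mem_filter, true_and, hr, map_sub,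
          Polynomial.eval_sub, ← h1, ← h2, polyHash]
        ring
      · rintro ⟨⟨z, x, y⟩, h1, h2⟩ ⟨⟨z', x', y'⟩, h1', h2'⟩ h
        simp only [Subtype.mk.injEq, Sigma.mk.injEq, heq_eq_eq] at h
        obtain ⟨rfl, rfl⟩ := h
        simp only [polyHash] at h1 h1'
        rw [← h1'] at h1
        simpa using h1
    have h2 : ∀ z : L, (Finset.univ.filter fun x => r z x = b₁ - b₂).card
        ≤ (if (Polynomial.ofFn T (a₁ - a₂)).eval z = 0 then Fintype.card F else 0) + k := by
      intro z
      split_ifs with hz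
      · exact (Finset.card_le_univ _).trans (Nat.le_add_right _ _)
      · rw [zero_add]
        apply card_eval_X_mul_ofFn_eq_le
        intro h
        apply hz
        rw [map_sub, Polynomial.eval_sub, he (sub_eq_zero.1 h), sub_self]
    have h3 : ∑ z : L, (Finset.univ.filter fun x => r z x = b₁ - b₂).card
        ≤ (T - 1) * Fintype.card F + Fintype.card L * k := by
      refine (Finset.sum_le_sum fun z _ => h2 z).trans ?_
      rw [Finset.sum_add_distrib, ← Finset.sum_filter, Finset.sum_const, Finset.sum_const]
      simp only [smul_eq_mul, Finset.card_univ]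
      gcongr
      exact card_zeros_ofFn_le (sub_ne_zero.2 ha)
    have h4 : (Fintype.card {v : L × F × F // polyHash e v a₁ = b₁ ∧ polyHash e v a₂ = b₂} : ℝ)
        ≤ ((T : ℝ) - 1) * Fintype.card F + Fintype.card L * k := by
      have := h1.trans h3
      rw [← Nat.cast_one, ← Nat.cast_sub hT]
      exact_mod_cast this
    rw [Fintype.card_congr' (by congr!)]
    refine h4.trans (le_of_eq ?_)
    field_simp
    ring

theorem IsAlmostStronglyUniversal.transport {V A B V' A' B' : Type*} [Fintype V] [Fintype B]
    [Fintype V'] [Fintype B'] {h : V → A → B} {ε : ℝ} (H : IsAlmostStronglyUniversal h ε)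
    (eV : V' ≃ V) (eA : A' ≃ A) (eB : B ≃ B') :
    IsAlmostStronglyUniversal (fun v a => eB (h (eV v) (eA a))) ε := by
  classical
  rw [IsAlmostStronglyUniversal, Fintype.card_congr eV, ← Fintype.card_congr eB]
  refine ⟨fun a b => ?_, fun a₁ a₂ ha b₁ b₂ => ?_⟩
  · rw [← H.1 (eA a) (eB.symm b)]
    congr 1
    exact Fintype.card_congr (eV.subtypeEquiv fun v => by simp [Equiv.eq_symm_apply])
  · refine le_trans (le_of_eq ?_) (H.2 (eA a₁) (eA a₂) (by simpa using ha) (eB.symm b₁) (eB.symm b₂))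
    congr 1
    exact Fintype.card_congr (eV.subtypeEquiv fun v => by simp [Equiv.eq_symm_apply])

/-- Take `|F| = q`, `|L| = q ^ k` and words of length `q ^ t` over `L`. Only a bijection between `L`
and `F ^ k` is needed, not a linear one. -/
theorem exists_hash_class {m k t : ℕ} (hm : 1 ≤ m) (hk : 1 ≤ k) :
    ∃ h : Fin ((2 ^ m) ^ (k + 2)) → Fin ((2 ^ m) ^ (k * (2 ^ m) ^ t)) → Fin (2 ^ m),
      IsAlmostStronglyUniversal h
        ((k : ℝ) / 2 ^ m + ((2 ^ m : ℝ) ^ t - 1) / (2 ^ m : ℝ) ^ k) := by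
  classical
  have : Fact (Nat.Prime 2) := ⟨Nat.prime_two⟩
  let F := GaloisField 2 m
  let L := GaloisField 2 (m * k)
  let _ : Fintype F := Fintype.ofFinite F
  let _ : Fintype L := Fintype.ofFinite L
  have cF : Fintype.card F = 2 ^ m := by
    rw [← Nat.card_eq_fintype_card]; exact GaloisField.card 2 m (by omega)
  have cL : Fintype.card L = (2 ^ m) ^ k := by
    rw [← Nat.card_eq_fintype_card, ← pow_mul]
    exact GaloisField.card 2 (m * k) (Nat.mul_ne_zero (by omega) (by omega))
  have e : L ≃ (Fin k → F) := Fintype.equivOfCardEq (by rw [cL]; simp [cF])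
  have eV : Fin ((2 ^ m) ^ (k + 2)) ≃ L × F × F := Fintype.equivOfCardEq (by
    rw [Fintype.card_prod, Fintype.card_prod, cF, cL, Fintype.card_fin]; ring)
  have eA : Fin ((2 ^ m) ^ (k * (2 ^ m) ^ t)) ≃ (Fin ((2 ^ m) ^ t) → L) :=
    Fintype.equivOfCardEq (by
      rw [Fintype.card_fun, cL, Fintype.card_fin, Fintype.card_fin, pow_mul])
  have eB : F ≃ Fin (2 ^ m) := Fintype.equivOfCardEq (by simp [cF])
  have H := (polyHash_universal (T := (2 ^ m) ^ t) (Nat.one_le_pow _ _ (by positivity))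
    e.injective).transport eV eA eB
  rw [cF, cL] at H
  push_cast at H
  exact ⟨_, H⟩

/-! ### Feinstein's maximal code construction -/

open Classical in
/-- Feinstein's lemma. -/
theorem feinstein_greedy {A B : Type*} [Fintype A] [Fintype B] {p : A → ℝ} {w : A → B → ℝ}
    (hp : ∀ a, 0 ≤ p a) (hp1 : ∑ a, p a = 1) (hw : ∀ a b, 0 ≤ w a b) (hw1 : ∀ a, ∑ b, w a b = 1)
    {E : A → B → Prop} {θ ε η : ℝ} (hθ : 0 < θ)
    (hE : ∀ a b, E a b → θ * ∑ a', p a' * w a' b ≤ w a b)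
    (hη : ∑ a, p a * ∑ b, (if E a b then 0 else w a b) ≤ η) (M : ℕ) (hM : (M : ℝ) ≤ θ * (ε - η)) :
    ∃ x : ℕ → A, ∀ i < M,
      1 - ε ≤ ∑ b, if E (x i) b ∧ ∀ j < i, ¬ E (x j) b then w (x i) b else 0 := by
  induction M with
  | zero =>
    have : Nonempty A := by
      by_contra h
      rw [not_nonempty_iff] at h
      simp at hp1
    exact ⟨fun _ => Classical.arbitrary A, by simp⟩
  | succ M ih =>
    push_cast at hM
    obtain ⟨x, hx⟩ := ih (by linarith)
    by_cases H : ∃ a, 1 - ε ≤ ∑ b, if E a b ∧ ∀ j < M, ¬ E (x j) b then w a b else 0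
    · obtain ⟨a, ha⟩ := H
      refine ⟨Function.update x M a, fun i hi => ?_⟩
      have key : ∀ j < M, Function.update x M a j = x j := fun j hj =>
        Function.update_of_ne hj.ne _ _
      rcases Nat.lt_succ_iff_lt_or_eq.1 hi with h | rfl
      · rw [key i h]
        convert hx i h using 5 with b _ j
        exact imp_congr_right fun hj => by rw [key j (hj.trans h)]
      · rw [Function.update_self]
        convert ha using 5 with b _ j
        exact imp_congr_right fun hj => by rw [key j hj]
    · exfalso
      -- If no further codeword fits, averaging over `p` shows that the regions of the first `M`
      -- codewords must carry mass at least `ε - η` under the output law `q`. Each region has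
      -- `q`-mass at most `1 / θ`, so `M ≥ θ (ε - η)`, contradicting the bound for `M + 1`.
      push Not at H
      set q : B → ℝ := fun b => ∑ a', p a' * w a' b with hq
      have hq0 : ∀ b, 0 ≤ q b := fun b =>
        Finset.sum_nonneg fun a _ => mul_nonneg (hp a) (hw a b)
      have h1 : ∀ a, 1 ≤ (1 - ε) + ∑ b, (if E a b then 0 else w a b)
          + ∑ b, ∑ j ∈ Finset.range M, if E (x j) b then w a b else 0 := by
        intro a
        have : ∑ b, w a b ≤ (∑ b, if E a b ∧ ∀ j < M, ¬ E (x j) b then w a b else 0)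
            + ∑ b, (if E a b then 0 else w a b)
            + ∑ b, ∑ j ∈ Finset.range M, if E (x j) b then w a b else 0 := by
          rw [← Finset.sum_add_distrib, ← Finset.sum_add_distrib]
          refine Finset.sum_le_sum fun b _ => ?_
          have h0 := hw a b
          have hs : 0 ≤ ∑ j ∈ Finset.range M, if E (x j) b then w a b else 0 :=
            Finset.sum_nonneg fun j _ => by split_ifs <;> simp [h0]
          by_cases hab : E a b
          · by_cases hj : ∀ j < M, ¬ E (x j) b
            · simp only [hab, true_and, if_true]
              rw [if_pos (by simpa using hj)]
              linarith
            · have hs' : w a b ≤ ∑ j ∈ Finset.range M, if E (x j) b then w a b else 0 := by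
                push Not at hj
                obtain ⟨j, hj, hjb⟩ := hj
                have := Finset.single_le_sum
                  (f := fun j => if E (x j) b then w a b else 0)
                  (fun j _ => by split_ifs <;> simp [h0]) (Finset.mem_range.2 hj)
                simpa [hjb] using this
              simp only [hab, hj, and_false, if_true, if_false]
              linarith
          · simp only [hab, false_and, if_false]
            linarith
        rw [hw1 a] at this
        have := H a
        linarith
      have h2 : ∑ a, p a * ∑ b, ∑ j ∈ Finset.range M, (if E (x j) b then w a b else 0)
          ≤ M / θ := by
        calc _ = ∑ j ∈ Finset.range M, ∑ b, if E (x j) b then q b else 0 := by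
              simp_rw [Finset.mul_sum]
              rw [Finset.sum_comm' (t' := Finset.univ) (s' := fun _ => Finset.univ) (by simp)]
              rw [Finset.sum_comm' (s := Finset.range M) (t' := Finset.univ)
                (s' := fun _ => Finset.range M) (by simp)]
              refine Finset.sum_congr rfl fun b _ => ?_
              rw [Finset.sum_comm]
              refine Finset.sum_congr rfl fun j _ => ?_
              split_ifs <;> simp [hq]
          _ ≤ ∑ j ∈ Finset.range M, 1 / θ := by
              refine Finset.sum_le_sum fun j _ => ?_
              rw [← hw1 (x j), Finset.sum_div]
              refine Finset.sum_le_sum fun b _ => ?_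
              split_ifs with h
              · rw [le_div_iff₀ hθ, mul_comm]
                exact hE _ _ h
              · exact div_nonneg (hw _ _) hθ.le
          _ = M / θ := by simp; ring
      have h3 : (1 : ℝ) ≤ (1 - ε) + η + M / θ := by
        calc (1 : ℝ) = ∑ a, p a * 1 := by simp [hp1]
          _ ≤ ∑ a, p a * ((1 - ε) + ∑ b, (if E a b then 0 else w a b)
              + ∑ b, ∑ j ∈ Finset.range M, if E (x j) b then w a b else 0) :=
              Finset.sum_le_sum fun a _ => mul_le_mul_of_nonneg_left (h1 a) (hp a)
          _ = (1 - ε) + ∑ a, p a * ∑ b, (if E a b then 0 else w a b)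
              + ∑ a, p a * ∑ b, ∑ j ∈ Finset.range M, (if E (x j) b then w a b else 0) := by
              simp_rw [mul_add, Finset.sum_add_distrib]
              rw [← Finset.sum_mul, hp1, one_mul]
          _ ≤ _ := by linarith
      have h4 : θ * (ε - η) ≤ M := by
        have : ε - η ≤ M / θ := by linarith
        rwa [le_div_iff₀ hθ, mul_comm] at this
      linarith

-- Decoding to the first codeword whose region contains the output makes the greedy regions
-- disjoint; outputs in no region are decoded arbitrarily.
open Classical in
theorem exists_code_of_feinstein {A B S : Type*} [Fintype A] [Fintype B] [Fintype S] [Nonempty S]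
    {p : A → ℝ} {w : A → B → ℝ}
    (hp : ∀ a, 0 ≤ p a) (hp1 : ∑ a, p a = 1) (hw : ∀ a b, 0 ≤ w a b) (hw1 : ∀ a, ∑ b, w a b = 1)
    {E : A → B → Prop} {θ ε η : ℝ} (hθ : 0 < θ)
    (hE : ∀ a b, E a b → θ * ∑ a', p a' * w a' b ≤ w a b)
    (hη : ∑ a, p a * ∑ b, (if E a b then 0 else w a b) ≤ η)
    (hS : (Fintype.card S : ℝ) ≤ θ * (ε - η)) :
    ∃ (f : S → A) (g : B → S), ∀ s, ∑ b, (if g b = s then 0 else w (f s) b) ≤ ε := by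
  obtain ⟨x, hx⟩ := feinstein_greedy hp hp1 hw hw1 hθ hE hη _ hS
  let e := Fintype.equivFin S
  refine ⟨fun s => x (e s), fun b => if h : ∃ i : Fin (Fintype.card S), E (x i) b ∧
      ∀ j < i, ¬ E (x j) b then e.symm h.choose else Classical.arbitrary S, fun s => ?_⟩
  have h1 := hx (e s) (e s).2
  have h2 : ∀ b, (E (x (e s)) b ∧ ∀ j < (e s : ℕ), ¬ E (x j) b) →
      (if h : ∃ i : Fin (Fintype.card S), E (x i) b ∧
      ∀ j < i, ¬ E (x j) b then e.symm h.choose else Classical.arbitrary S) = s := by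
    rintro b ⟨hb, hb'⟩
    have h : ∃ i : Fin (Fintype.card S), E (x i) b ∧ ∀ j < i, ¬ E (x j) b :=
      ⟨e s, hb, fun j hj => hb' j hj⟩
    rw [dif_pos h, Equiv.symm_apply_eq]
    obtain ⟨c1, c2⟩ := h.choose_spec
    rcases lt_trichotomy h.choose (e s) with hlt | heq | hgt
    · exact absurd c1 (hb' _ hlt)
    · exact heq
    · exact absurd hb (c2 _ hgt)
  have h3 : ∑ b, (if E (x (e s)) b ∧ ∀ j < (e s : ℕ), ¬ E (x j) b then w (x (e s)) b else 0)
      + ∑ b, (if (if h : ∃ i : Fin (Fintype.card S), E (x i) b ∧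
      ∀ j < i, ¬ E (x j) b then e.symm h.choose else Classical.arbitrary S) = s then 0
        else w (x (e s)) b) ≤ ∑ b, w (x (e s)) b := by
    rw [← Finset.sum_add_distrib]
    refine Finset.sum_le_sum fun b _ => ?_
    have h0 := hw (x (e s)) b
    by_cases hb : E (x (e s)) b ∧ ∀ j < (e s : ℕ), ¬ E (x j) b
    · rw [if_pos hb, if_pos (h2 b hb), add_zero]
    · rw [if_neg hb, zero_add]
      split_ifs <;> simp [h0]
  rw [hw1] at h3
  linarith

/-! ### The channel coding theorem -/

theorem Fintype.sum_sum_prod_eq_pow {X Y : Type*} [Fintype X] [Fintype Y] (φ : X → Y → ℝ) (n : ℕ) :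
    ∑ x : Fin n → X, ∑ y : Fin n → Y, ∏ s, φ (x s) (y s) = (∑ x, ∑ y, φ x y) ^ n := by
  classical
  rw [Fintype.sum_pow]
  exact Finset.sum_congr rfl fun x _ => by rw [Finset.prod_univ_sum, Fintype.piFinset_univ]

namespace DMC

variable {X Y : Type*} [Fintype Y]

theorem wordProb_nonneg (W : DMC X Y) {n : ℕ} (x : Fin n → X) (y : Fin n → Y) :
    0 ≤ W.wordProb x y :=
  Finset.prod_nonneg fun s _ => (W (x s)).2.1 _

theorem sum_wordProb (W : DMC X Y) {n : ℕ} (x : Fin n → X) : ∑ y, W.wordProb x y = 1 := by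
  classical
  have := Finset.prod_univ_sum (fun _ : Fin n => (Finset.univ : Finset Y))
    (fun s y => (W (x s)).1 y)
  rw [Fintype.piFinset_univ] at this
  rw [show (∑ y, W.wordProb x y) = ∑ y : Fin n → Y, ∏ s, (W (x s)).1 (y s) from rfl, ← this]
  exact Finset.prod_eq_one fun s _ => (W (x s)).2.2

variable [Fintype X]

theorem sum_prod_mul_wordProb (W : DMC X Y) (P : stdSimplex ℝ X) {n : ℕ} (y : Fin n → Y) :
    ∑ x : Fin n → X, (∏ s, P.1 (x s)) * W.wordProb x y
      = ∏ s, ∑ x, P.1 x * (W x).1 (y s) := by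
  classical
  rw [Finset.prod_univ_sum, Fintype.piFinset_univ]
  exact Finset.sum_congr rfl fun x _ => by rw [wordProb, ← Finset.prod_mul_distrib]

/-- A Chernoff exponent for the lower tail of the information density. -/
theorem exists_chernoff_lt_one (W : DMC X Y) (P : stdSimplex ℝ X) {γ : ℝ}
    (hγ : γ < W.mutualInfo P) :
    ∃ θ : ℝ, 0 < θ ∧ ∑ x, ∑ y, P.1 x * (W x).1 y * Real.exp
      (θ * (γ - Real.logb 2 ((W x).1 y / ∑ x', P.1 x' * (W x').1 y))) < 1 := by
  have hPW : ∑ x, ∑ y, P.1 x * (W x).1 y = 1 := by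
    simp_rw [← Finset.mul_sum]
    calc _ = ∑ x, P.1 x := Finset.sum_congr rfl fun x _ => by
          rw [show ∑ y, (W x).1 y = 1 from (W x).2.2, mul_one]
      _ = 1 := P.2.2
  set i : X → Y → ℝ := fun x y => Real.logb 2 ((W x).1 y / ∑ x', P.1 x' * (W x').1 y) with hi
  set φ : ℝ → ℝ := fun θ => ∑ x, ∑ y, P.1 x * (W x).1 y * Real.exp (θ * (γ - i x y)) with hφ
  have hd : HasDerivAt φ (∑ x, ∑ y, P.1 x * (W x).1 y * (γ - i x y)) 0 := by
    refine HasDerivAt.fun_sum fun x _ => HasDerivAt.fun_sum fun y _ => ?_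
    have h := (((hasDerivAt_id (0 : ℝ)).mul_const (γ - i x y)).exp).const_mul
      (P.1 x * (W x).1 y)
    simpa using h
  have hneg : ∑ x, ∑ y, P.1 x * (W x).1 y * (γ - i x y) = γ - W.mutualInfo P := by
    simp_rw [mul_sub, Finset.sum_sub_distrib, ← Finset.sum_mul]
    rw [hPW, one_mul]
    rfl
  -- Since `φ 0 = 1` and `φ` has negative derivative `γ - I` at `0`, it drops below `1` at some
  -- small positive `θ`.
  rw [hneg, hasDerivAt_iff_tendsto_slope] at hd
  have hev := (hd.mono_left (nhdsWithin_mono (0 : ℝ)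
    (fun x (hx : x ∈ Set.Ioi (0 : ℝ)) => ne_of_gt hx))).eventually_lt_const (sub_neg.2 hγ)
  obtain ⟨θ, hθ, hpos⟩ := (hev.and self_mem_nhdsWithin).exists
  have hpos : 0 < θ := hpos
  refine ⟨θ, hpos, ?_⟩
  have h0 : φ 0 = 1 := by simp [hφ, hPW]
  rw [slope_def_field, sub_zero, h0] at hθ
  have := (div_lt_iff₀ hpos).1 hθ
  simp only [hφ] at this
  linarith

-- Where the likelihood ratio is below `2 ^ (n γ)`, the exponential weight is at least `1`; its
-- expectation factors over the letters.
open Classical in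
theorem sum_infoDensity_tail_le (W : DMC X Y) (P : stdSimplex ℝ X) {γ θ : ℝ} (hθ : 0 < θ) (n : ℕ) :
    ∑ x : Fin n → X, (∏ s, P.1 (x s)) * ∑ y : Fin n → Y,
      (if (2 : ℝ) ^ (n * γ) * ∏ s, ∑ x', P.1 x' * (W x').1 (y s) ≤ W.wordProb x y then 0
        else W.wordProb x y)
      ≤ (∑ x, ∑ y, P.1 x * (W x).1 y * Real.exp
      (θ * (γ - Real.logb 2 ((W x).1 y / ∑ x', P.1 x' * (W x').1 y)))) ^ n := by
  rw [← Fintype.sum_sum_prod_eq_pow]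
  refine Finset.sum_le_sum fun x _ => ?_
  rw [Finset.mul_sum]
  refine Finset.sum_le_sum fun y _ => ?_
  rw [Finset.prod_mul_distrib, Finset.prod_mul_distrib]
  have hP : 0 ≤ ∏ s, P.1 (x s) := Finset.prod_nonneg fun s _ => P.2.1 _
  have hW := W.wordProb_nonneg x y
  have hexp : 0 ≤ ∏ s, Real.exp (θ * (γ - Real.logb 2 ((W (x s)).1 (y s) /
      ∑ x', P.1 x' * (W x').1 (y s)))) := Finset.prod_nonneg fun s _ => (Real.exp_pos _).le
  split_ifs with h
  · rw [mul_zero]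
    exact mul_nonneg (mul_nonneg hP hW) hexp
  · change _ ≤ (∏ s, P.1 (x s)) * W.wordProb x y * _
    -- Zero-probability pairs are removed first, so that every logarithm below has a positive
    -- argument.
    rcases hP.eq_or_lt with hP0 | hPpos
    · simp [← hP0]
    rcases hW.eq_or_lt with hW0 | hWpos
    · simp [← hW0]
    refine le_mul_of_one_le_right (mul_nonneg hP hW) ?_
    have hPs : ∀ s, 0 < P.1 (x s) := fun s => lt_of_le_of_ne (P.2.1 _) fun h0 =>
      hPpos.ne' (Finset.prod_eq_zero (Finset.mem_univ s) h0.symm)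
    have hWs : ∀ s, 0 < (W (x s)).1 (y s) := fun s => lt_of_le_of_ne ((W (x s)).2.1 _) fun h0 =>
      hWpos.ne' (Finset.prod_eq_zero (Finset.mem_univ s) h0.symm)
    have hQs : ∀ s, 0 < ∑ x', P.1 x' * (W x').1 (y s) := fun s =>
      lt_of_lt_of_le (mul_pos (hPs s) (hWs s)) (Finset.single_le_sum
        (f := fun x' => P.1 x' * (W x').1 (y s))
        (fun x' _ => mul_nonneg (P.2.1 x') ((W x').2.1 _)) (Finset.mem_univ (x s)))
    rw [← Real.exp_sum, ← Finset.mul_sum, Real.one_le_exp_iff]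
    refine mul_nonneg hθ.le ?_
    rw [Finset.sum_sub_distrib, sub_nonneg, ← Real.logb_prod _ _ fun s _ =>
      (div_pos (hWs s) (hQs s)).ne', Finset.prod_div_distrib]
    change Real.logb 2 (W.wordProb x y / _) ≤ _
    have hQ : 0 < ∏ s, ∑ x', P.1 x' * (W x').1 (y s) := Finset.prod_pos fun s _ => hQs s
    rw [Real.logb_le_iff_le_rpow one_lt_two (div_pos hWpos hQ), div_le_iff₀ hQ]
    simpa using (not_le.1 h).le

open Classical in
/-- The direct part of the channel coding theorem, with maximal error probability. -/
theorem eventually_exists_code (W : DMC X Y) (hC : 0 < W.capacity) {γ : ℝ} (hγ : γ < W.capacity)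
    {ε : ℝ} (hε : 0 < ε) :
    ∀ᶠ n : ℕ in Filter.atTop, ∀ (S : Type) [Fintype S] [Nonempty S],
      (Fintype.card S : ℝ) ≤ (2 : ℝ) ^ (n * γ) →
      ∃ (f : S → Fin n → X) (g : (Fin n → Y) → S),
        ∀ s, ∑ y, (if g y = s then 0 else W.wordProb (f s) y) ≤ ε := by
  have hne : Nonempty (stdSimplex ℝ X) := by
    by_contra h
    rw [not_nonempty_iff] at h
    rw [capacity, Real.iSup_of_isEmpty] at hC
    exact lt_irrefl _ hC
  obtain ⟨P, hP⟩ := exists_lt_of_lt_ciSup hγ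
  obtain ⟨γ', h1, h2⟩ := exists_between hP
  obtain ⟨θ, hθ, hr⟩ := W.exists_chernoff_lt_one P h2
  set r := ∑ x, ∑ y, P.1 x * (W x).1 y * Real.exp
      (θ * (γ' - Real.logb 2 ((W x).1 y / ∑ x', P.1 x' * (W x').1 y))) with hrdef
  have hr0 : 0 ≤ r := Finset.sum_nonneg fun x _ => Finset.sum_nonneg fun y _ =>
    mul_nonneg (mul_nonneg (P.2.1 _) ((W x).2.1 _)) (Real.exp_pos _).le
  have e1 := (tendsto_pow_atTop_nhds_zero_of_lt_one hr0 hr).eventually_le_const (half_pos hε)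
  -- The gap `γ' - γ` absorbs the factor `ε - r ^ n ≥ ε / 2` lost in Feinstein's bound.
  have e2 : ∀ᶠ n : ℕ in Filter.atTop, 2 / ε ≤ ((2 : ℝ) ^ (γ' - γ)) ^ n :=
    (tendsto_pow_atTop_atTop_of_one_lt
      (Real.one_lt_rpow one_lt_two (sub_pos.2 h1))).eventually_ge_atTop _
  filter_upwards [e1, e2] with n hn1 hn2 S _ _ hS
  refine exists_code_of_feinstein (p := fun x : Fin n → X => ∏ s, P.1 (x s))
    (w := fun x y => W.wordProb x y) (θ := (2 : ℝ) ^ (n * γ')) (η := r ^ n)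
    (E := fun x y => (2 : ℝ) ^ (n * γ') * ∏ s, ∑ x', P.1 x' * (W x').1 (y s) ≤ W.wordProb x y)
    (fun x => Finset.prod_nonneg fun s _ => P.2.1 _) ?_ (fun x y => W.wordProb_nonneg x y)
    W.sum_wordProb (by positivity) ?_ ?_ ?_
  · rw [← Fintype.sum_pow, show ∑ x, P.1 x = 1 from P.2.2, one_pow]
  · intro x y h
    rwa [sum_prod_mul_wordProb]
  · exact W.sum_infoDensity_tail_le P hθ n
  · refine hS.trans ?_
    have hsplit : (2 : ℝ) ^ (n * γ') = (2 : ℝ) ^ (n * γ) * ((2 : ℝ) ^ (γ' - γ)) ^ n := by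
      rw [← Real.rpow_mul_natCast zero_le_two, ← Real.rpow_add two_pos]
      congr 1
      ring
    rw [hsplit, mul_assoc]
    refine le_mul_of_one_le_right (by positivity) ?_
    calc (1 : ℝ) = 2 / ε * (ε / 2) := by field_simp
      _ ≤ ((2 : ℝ) ^ (γ' - γ)) ^ n * (ε - r ^ n) := by
        gcongr
        linarith

end DMC

/-! ### Hash collisions and the two error types -/

theorem firstRank_le_castSucc {B : Type*} {K : ℕ} {b : B} {β : Fin K → B} {j : Fin K}
    (h : β j = b) : firstRank b β ≤ j.castSucc := by
  classical
  rw [firstRank, dif_pos ⟨j, h⟩, Fin.castSucc_le_castSucc_iff]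
  exact Fin.find_le_of_pos _ h

theorem exists_of_firstRank_lt {B : Type*} {K : ℕ} {b : B} {β : Fin K → B} {r : Fin (K + 1)}
    (h : firstRank b β < r) : ∃ j, β j = b ∧ j.castSucc < r := by
  classical
  rw [firstRank] at h
  split_ifs at h with hex
  · exact ⟨_, Fin.find_spec hex, h⟩
  · exact absurd h (Fin.le_last r).not_gt

theorem firstRank_map_le {A B : Type*} {K : ℕ} (h : A → B) (a : A) (κ : Fin K → A) :
    firstRank (h a) (fun j => h (κ j)) ≤ firstRank a κ := by
  by_contra! hlt
  obtain ⟨j, hj, hjr⟩ := exists_of_firstRank_lt hlt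
  exact hjr.not_ge (firstRank_le_castSucc (congrArg h hj))

theorem exists_collision_of_firstRank_lt {A B : Type*} {K : ℕ} {h : A → B} {a : A} {κ : Fin K → A}
    (hlt : firstRank (h a) (fun j => h (κ j)) < firstRank a κ) :
    ∃ j, κ j ≠ a ∧ h (κ j) = h a := by
  obtain ⟨j, hj, hjr⟩ := exists_of_firstRank_lt hlt
  exact ⟨j, fun h => hjr.not_ge (firstRank_le_castSucc h), hj⟩

/-- Sum the pair bound `ε |V| / |B|` over the `|B|` possible common values. -/
theorem IsAlmostStronglyUniversal.card_collision_le {V A B : Type*} [Fintype V] [Fintype B]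
    [Nonempty B] [DecidableEq B] {h : V → A → B} {ε : ℝ} (H : IsAlmostStronglyUniversal h ε)
    {a₁ a₂ : A} (ha : a₁ ≠ a₂) :
    ((Finset.univ.filter fun v => h v a₁ = h v a₂).card : ℝ) ≤ ε * Fintype.card V := by
  classical
  have h1 : (Finset.univ.filter fun v => h v a₁ = h v a₂).card
      = ∑ b, (Finset.univ.filter fun v => h v a₁ = b ∧ h v a₂ = b).card := by
    rw [Finset.card_eq_sum_card_fiberwise (f := fun v => h v a₂) (t := Finset.univ) (by simp)]
    refine Finset.sum_congr rfl fun b _ => congrArg _ ?_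
    ext v
    simp only [Finset.mem_filter, Finset.mem_univ, true_and]
    constructor
    · rintro ⟨h1, h2⟩
      exact ⟨h1.trans h2, h2⟩
    · rintro ⟨h1, h2⟩
      exact ⟨h1.trans h2.symm, h2⟩
  have h2 : ∀ b, ((Finset.univ.filter fun v => h v a₁ = b ∧ h v a₂ = b).card : ℝ)
      ≤ ε * ((Fintype.card V : ℝ) / Fintype.card B) := fun b => by
    have := H.2 a₁ a₂ ha b b
    rwa [Fintype.card_subtype] at this
  rw [h1]
  push_cast
  refine (Finset.sum_le_sum fun b _ => h2 b).trans (le_of_eq ?_)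
  have : (Fintype.card B : ℝ) ≠ 0 := by exact_mod_cast Fintype.card_ne_zero
  rw [Finset.sum_const, Finset.card_univ, nsmul_eq_mul]
  field_simp

namespace RMOIDCode

variable {X Y : Type*} [Fintype Y] {K n N M : ℕ}

theorem decProb_nonneg (c : RMOIDCode X Y K n N M) (W : DMC X Y) (κ : Fin K ↪ Fin N) (i : Fin N)
    (p : Fin (K + 1) → Prop) : 0 ≤ c.decProb W κ i p :=
  Finset.sum_nonneg fun _ _ => mul_nonneg (by positivity) <| Finset.sum_nonneg fun _ _ => by
    split_ifs
    · exact W.wordProb_nonneg _ _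
    · exact le_rfl

theorem typeI_nonneg (c : RMOIDCode X Y K n N M) (W : DMC X Y) : 0 ≤ c.typeI W :=
  Real.iSup_nonneg fun _ => Real.iSup_nonneg fun _ => c.decProb_nonneg _ _ _ _

theorem typeII_nonneg (c : RMOIDCode X Y K n N M) (W : DMC X Y) : 0 ≤ c.typeII W :=
  Real.iSup_nonneg fun _ => Real.iSup_nonneg fun _ => c.decProb_nonneg _ _ _ _

end RMOIDCode

namespace RankedScheme

variable {X Y : Type*} [Fintype Y] {K n : ℕ}

open Classical in
theorem typeI_le (S : RankedScheme X Y K n) (W : DMC X Y) {δ : ℝ} (hδ : 0 ≤ δ)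
    (h : ∀ s, ∑ y, (if S.g y = s then 0 else W.wordProb (S.f s) y) ≤ δ) :
    S.code.typeI W ≤ δ := by
  refine Real.iSup_le (fun κ => Real.iSup_le (fun i => ?_) hδ) hδ
  have hcard : ((2 ^ S.m) ^ (S.k + 2) : ℕ) ≠ 0 := by positivity
  calc _ ≤ ∑ v : Fin ((2 ^ S.m) ^ (S.k + 2)), (1 / (((2 ^ S.m) ^ (S.k + 2) : ℕ) : ℝ)) * δ := by
        refine Finset.sum_le_sum fun v _ => mul_le_mul_of_nonneg_left ?_ (by positivity)
        refine le_trans (Finset.sum_le_sum fun y _ => ?_) (h (v, fun j => S.hash v (κ j)))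
        have h0 := W.wordProb_nonneg (S.code.enc κ v) y
        by_cases hg : S.g y = (v, fun j => S.hash v (κ j))
        · have : ¬ firstRank i κ < S.code.dec i y := by
            simp only [code, hg, not_lt]
            exact firstRank_map_le _ _ _
          simp [this, hg]
        · rw [if_neg hg]
          split_ifs
          · exact le_rfl
          · exact h0
    _ = δ := by
        rw [Finset.sum_const, Finset.card_univ, Fintype.card_fin, nsmul_eq_mul, ← mul_assoc,
          mul_one_div_cancel (by exact_mod_cast hcard), one_mul]

-- For keys without a collision only a transmission error can lower the rank; for colliding keys the
-- error is bounded by `1`, hence by the number of collisions.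
open Classical in
theorem typeII_le (S : RankedScheme X Y K n) (W : DMC X Y) {δ : ℝ} (hδ : 0 ≤ δ)
    (h : ∀ s, ∑ y, (if S.g y = s then 0 else W.wordProb (S.f s) y) ≤ δ) :
    S.code.typeII W
      ≤ δ + K * ((S.k : ℝ) / 2 ^ S.m + ((2 ^ S.m : ℝ) ^ S.t - 1) / (2 ^ S.m : ℝ) ^ S.k) := by
  set ε : ℝ := (S.k : ℝ) / 2 ^ S.m + ((2 ^ S.m : ℝ) ^ S.t - 1) / (2 ^ S.m : ℝ) ^ S.k with hεdef
  have hε : 0 ≤ ε := by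
    have h1 : (1 : ℝ) ≤ (2 ^ S.m : ℝ) ^ S.t := one_le_pow₀ (one_le_pow₀ one_le_two)
    exact add_nonneg (by positivity) (div_nonneg (by linarith) (by positivity))
  have hpos : 0 ≤ δ + K * ε := by positivity
  refine Real.iSup_le (fun κ => Real.iSup_le (fun i => ?_) hpos) hpos
  set M : ℕ := (2 ^ S.m) ^ (S.k + 2) with hM
  have hcard : (M : ℝ) ≠ 0 := by
    have : M ≠ 0 := by positivity
    exact_mod_cast this
  have hMpos : (0 : ℝ) ≤ 1 / M := by positivity
  set coll : Fin M → Fin K → Prop := fun v j => κ j ≠ i ∧ S.hash v (κ j) = S.hash v i with hcoll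
  have hv : ∀ v : Fin M, (∑ y : Fin n → Y, if S.code.dec i y < firstRank i κ
      then W.wordProb (S.code.enc κ v) y else 0) ≤ δ + ∑ j, if coll v j then 1 else 0 := by
    intro v
    by_cases hc : ∃ j, coll v j
    · obtain ⟨j, hj⟩ := hc
      have h1 : (1 : ℝ) ≤ ∑ j, if coll v j then 1 else 0 := by
        have := Finset.single_le_sum (f := fun j => if coll v j then (1 : ℝ) else 0)
          (fun j _ => by split_ifs <;> simp) (Finset.mem_univ j)
        simpa [hj] using this
      have h2 : (∑ y : Fin n → Y, if S.code.dec i y < firstRank i κ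
          then W.wordProb (S.code.enc κ v) y else 0) ≤ 1 := by
        rw [← W.sum_wordProb (S.code.enc κ v)]
        refine Finset.sum_le_sum fun y _ => ?_
        split_ifs
        · exact le_rfl
        · exact W.wordProb_nonneg _ _
      linarith
    · have h0 : (0 : ℝ) ≤ ∑ j, if coll v j then 1 else 0 :=
        Finset.sum_nonneg fun j _ => by split_ifs <;> simp
      have h1 := h (v, fun j => S.hash v (κ j))
      refine le_trans ?_ (h1.trans (le_add_of_nonneg_right h0))
      refine Finset.sum_le_sum fun y _ => ?_
      by_cases hg : S.g y = (v, fun j => S.hash v (κ j))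
      · have : ¬ S.code.dec i y < firstRank i κ := by
          intro hlt
          simp only [code, hg] at hlt
          exact hc (exists_collision_of_firstRank_lt (h := S.hash v) hlt)
        simp [this, hg]
      · rw [if_neg hg]
        split_ifs
        · exact le_rfl
        · exact W.wordProb_nonneg _ _
  have hj : ∀ j, (∑ v, if coll v j then (1 : ℝ) else 0) ≤ ε * M := by
    intro j
    rw [Finset.sum_boole]
    by_cases hji : κ j = i
    · simp only [hcoll, hji, ne_eq, not_true_eq_false, false_and, Finset.filter_false,
        Finset.card_empty, Nat.cast_zero]
      positivity
    · have := S.hash_universal.card_collision_le hji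
      rw [Fintype.card_fin] at this
      simpa only [hcoll, ne_eq, hji, not_false_eq_true, true_and] using this
  calc S.code.decProb W κ i (fun j => j < firstRank i κ)
      ≤ ∑ v : Fin M, (1 / (M : ℝ)) * (δ + ∑ j, if coll v j then 1 else 0) :=
        Finset.sum_le_sum fun v _ => mul_le_mul_of_nonneg_left
          (le_trans (le_of_eq (Finset.sum_congr rfl fun y _ => by congr)) (hv v)) hMpos
    _ = δ + (1 / M) * ∑ j, ∑ v, (if coll v j then (1 : ℝ) else 0) := by
        rw [← Finset.mul_sum, Finset.sum_add_distrib, Finset.sum_comm, Finset.sum_const,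
          Finset.card_univ, Fintype.card_fin, nsmul_eq_mul, mul_add, ← mul_assoc,
          one_div_mul_cancel hcard, one_mul]
    _ ≤ δ + (1 / M) * ∑ j : Fin K, ε * M := by
        gcongr with j
        exact hj j
    _ = δ + K * ε := by
        rw [Finset.sum_const, Finset.card_univ, Fintype.card_fin, nsmul_eq_mul]
        field_simp

end RankedScheme

/-! ### Selection of a sequence and asymptotics of the parameters -/

theorem exists_tendsto_zero_of_eventually_lt {S : ℕ → Type*} [∀ n, Nonempty (S n)]
    {e : (n : ℕ) → S n → ℝ} (he : ∀ n s, 0 ≤ e n s)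
    (h : ∀ ε > 0, ∀ᶠ n in Filter.atTop, ∃ s, e n s < ε) :
    ∃ s : (n : ℕ) → S n, Filter.Tendsto (fun n => e n (s n)) Filter.atTop (nhds 0) := by
  have hb : ∀ n, BddBelow (Set.range (e n)) := fun n => ⟨0, by rintro _ ⟨s, rfl⟩; exact he n s⟩
  -- Near-minimizers, within `1 / (n + 1)` of the infimum, serve every tolerance at once.
  have hex : ∀ n : ℕ, ∃ s, e n s < (⨅ s, e n s) + 1 / ((n : ℝ) + 1) := fun n =>
    exists_lt_of_ciInf_lt (lt_add_of_pos_right _ (by positivity))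
  choose s hs using hex
  refine ⟨s, ?_⟩
  rw [Metric.tendsto_nhds]
  intro ε hε
  have h1 := (tendsto_one_div_add_atTop_nhds_zero_nat (𝕜 := ℝ)).eventually_lt_const (half_pos hε)
  filter_upwards [h (ε / 2) (half_pos hε), h1] with n ⟨s', hs'⟩ hn
  rw [Real.dist_0_eq_abs, abs_of_nonneg (he _ _)]
  have := ciInf_le (hb n) s'
  linarith [hs n]

theorem logb_logb_receivers {m k t : ℕ} (hm : 1 ≤ m) (hk : 1 ≤ k) :
    Real.logb 2 (Real.logb 2 (((2 ^ m) ^ (k * (2 ^ m) ^ t) : ℕ) : ℝ))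
      = Real.logb 2 (m * k : ℝ) + m * t := by
  have hm' : (m : ℝ) ≠ 0 := by positivity
  have hk' : (k : ℝ) ≠ 0 := by positivity
  have h1 : Real.logb 2 (((2 ^ m) ^ (k * (2 ^ m) ^ t) : ℕ) : ℝ) = (m * k : ℝ) * 2 ^ (m * t) := by
    push_cast
    rw [← pow_mul, Real.logb_pow, Real.logb_self_eq_one one_lt_two, ← pow_mul]
    push_cast
    ring
  rw [h1, Real.logb_mul (mul_ne_zero hm' hk') (by positivity), Real.logb_pow,
    Real.logb_self_eq_one one_lt_two]
  push_cast
  ring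

theorem tendsto_nat_sqrt_atTop : Filter.Tendsto Nat.sqrt Filter.atTop Filter.atTop :=
  Filter.tendsto_atTop.2 fun b => by
    filter_upwards [Filter.eventually_ge_atTop (b * b)] with n hn
    exact Nat.le_sqrt.2 hn

theorem tendsto_sqrt_div_self :
    Filter.Tendsto (fun n : ℕ => (n.sqrt : ℝ) / n) Filter.atTop (nhds 0) := by
  have h : Filter.Tendsto (fun n : ℕ => 1 / (n.sqrt : ℝ)) Filter.atTop (nhds 0) :=
    tendsto_one_div_atTop_nhds_zero_nat.comp tendsto_nat_sqrt_atTop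
  refine squeeze_zero' (Filter.Eventually.of_forall fun n => by positivity) ?_ h
  filter_upwards [Filter.eventually_ge_atTop 1] with n hn
  have h1 : (0 : ℝ) < n.sqrt := by exact_mod_cast Nat.sqrt_pos.2 hn
  have h2 : (n.sqrt * n.sqrt : ℝ) ≤ n := by exact_mod_cast Nat.sqrt_le n
  rw [div_le_div_iff₀ (by exact_mod_cast hn) h1, one_mul]
  exact h2

theorem tendsto_logb_mul_div_self {γ : ℝ} (hγ : 0 < γ) :
    Filter.Tendsto (fun n : ℕ => Real.logb 2 (n * γ) / n) Filter.atTop (nhds 0) := by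
  have h1 : Filter.Tendsto (fun x : ℝ => Real.log x / x) Filter.atTop (nhds 0) :=
    Real.isLittleO_log_id_atTop.tendsto_div_nhds_zero
  have h2 : Filter.Tendsto (fun n : ℕ => (n : ℝ) * γ) Filter.atTop Filter.atTop :=
    tendsto_natCast_atTop_atTop.atTop_mul_const hγ
  have h3 := (h1.comp h2).mul_const (γ / Real.log 2)
  rw [zero_mul] at h3
  refine h3.congr' ?_
  filter_upwards [Filter.eventually_ge_atTop 1] with n hn
  have hn' : (n : ℝ) ≠ 0 := by positivity
  have hl : Real.log 2 ≠ 0 := (Real.log_pos one_lt_two).ne'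
  simp only [Function.comp_apply, Real.logb]
  field_simp

theorem tendsto_hash_epsilon_bound (γ : ℝ) :
    Filter.Tendsto (fun n : ℕ => (n * γ + 1) / 2 ^ n.sqrt) Filter.atTop (nhds 0) := by
  have hp : ∀ j : ℕ, Filter.Tendsto (fun m : ℕ => (m : ℝ) ^ j / 2 ^ m) Filter.atTop (nhds 0) :=
    fun j => tendsto_pow_const_div_const_pow_of_one_lt j one_lt_two
  have h : Filter.Tendsto (fun m : ℕ => |γ| * ((m : ℝ) ^ 2 / 2 ^ m) + 2 * |γ| * ((m : ℝ) ^ 1 / 2 ^ m)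
      + (|γ| + 1) * ((m : ℝ) ^ 0 / 2 ^ m)) Filter.atTop (nhds 0) := by
    simpa using (((hp 2).const_mul |γ|).add ((hp 1).const_mul (2 * |γ|))).add
      ((hp 0).const_mul (|γ| + 1))
  refine squeeze_zero_norm (fun n => ?_) (h.comp tendsto_nat_sqrt_atTop)
  have h2 : (n : ℝ) ≤ (n.sqrt + 1) * (n.sqrt + 1) := by
    exact_mod_cast (Nat.lt_succ_sqrt n).le
  rw [norm_div, Real.norm_of_nonneg (by positivity : (0 : ℝ) ≤ 2 ^ n.sqrt)]
  have h3 : ‖(n : ℝ) * γ + 1‖ ≤ (n.sqrt + 1) * (n.sqrt + 1) * |γ| + 1 := by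
    refine (norm_add_le _ _).trans ?_
    rw [norm_mul, Real.norm_natCast, Real.norm_eq_abs, norm_one]
    gcongr
  refine (div_le_div_of_nonneg_right h3 (by positivity)).trans (le_of_eq ?_)
  simp only [Function.comp_apply]
  ring

/-- The message length is `m (k + 2 + K)` bits with `k = t + 1`. The choice `m = √n` is large enough
for `2 ^ m` to beat polynomials in `n`, and small enough for the rounding loss `O(m / n)` to vanish.
-/
theorem exists_hash_parameters {γ : ℝ} (hγ : 0 < γ) (K : ℕ) :
    ∀ᶠ n : ℕ in Filter.atTop, 1 ≤ n.sqrt ∧ ∃ t : ℕ,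
      (n.sqrt * (t + 3 + K) : ℝ) ≤ n * γ ∧ n * γ < n.sqrt * (t + 4 + K) := by
  have h : Filter.Tendsto (fun n : ℕ => (n.sqrt : ℝ) * γ) Filter.atTop Filter.atTop :=
    (tendsto_natCast_atTop_atTop.comp tendsto_nat_sqrt_atTop).atTop_mul_const hγ
  filter_upwards [tendsto_nat_sqrt_atTop.eventually_ge_atTop 1,
    h.eventually_ge_atTop ((3 + K : ℕ) : ℝ)] with n h1 h2
  refine ⟨h1, ⌊n * γ / n.sqrt⌋₊ - (3 + K), ?_⟩
  have hm : (0 : ℝ) < n.sqrt := by exact_mod_cast h1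
  have hsq : (n.sqrt * n.sqrt : ℝ) ≤ n := by exact_mod_cast Nat.sqrt_le n
  have h3 : ((3 + K : ℕ) : ℝ) ≤ n * γ / n.sqrt := by
    refine h2.trans ?_
    rw [le_div_iff₀ hm]
    nlinarith
  have h4 : 3 + K ≤ ⌊n * γ / n.sqrt⌋₊ := Nat.le_floor h3
  have h5 := Nat.floor_le (a := n * γ / n.sqrt) (by positivity)
  have h6 := Nat.lt_floor_add_one (n * γ / n.sqrt)
  rw [le_div_iff₀ hm] at h5
  rw [div_lt_iff₀ hm] at h6
  rw [Nat.cast_sub h4]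
  push_cast
  constructor <;> linarith

/-! ### Assembly of the schemes -/

namespace RankedScheme

variable {X Y : Type*} {K n : ℕ}

/-- Supplies a scheme at the small block lengths, where its quality does not matter. -/
theorem nonempty [Nonempty X] : Nonempty (RankedScheme X Y K n) := by
  obtain ⟨h, hh⟩ := exists_hash_class (m := 1) (k := 1) (t := 0) le_rfl le_rfl
  exact ⟨⟨1, le_rfl, 1, 0, rfl, h, hh, fun _ _ => Classical.arbitrary X,
    fun _ => (⟨0, by positivity⟩, fun _ => ⟨0, by positivity⟩)⟩⟩

theorem abs_rate_sub_le (S : RankedScheme X Y K n) {γ : ℝ} (hn : 1 ≤ n)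
    (h1 : (S.m * (S.t + 3 + K) : ℝ) ≤ n * γ) (h2 : n * γ < S.m * (S.t + 4 + K)) :
    |S.code.rate - γ| ≤ (4 + K) * (S.m / n) + Real.logb 2 (n * γ) / n := by
  have hn' : (0 : ℝ) < n := by exact_mod_cast hn
  have hm := S.hm
  have hk : 1 ≤ S.k := by have := S.ht; omega
  have hkt : (S.k : ℝ) = S.t + 1 := by exact_mod_cast S.ht.symm
  have hmR : (1 : ℝ) ≤ S.m := by exact_mod_cast hm
  have hkR : (1 : ℝ) ≤ S.k := by exact_mod_cast hk
  have hrate : S.code.rate = (Real.logb 2 (S.m * S.k : ℝ) + S.m * S.t) / n := by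
    rw [RMOIDCode.rate, logb_logb_receivers hm hk, one_div, inv_mul_eq_div]
  have hmk : (1 : ℝ) ≤ S.m * S.k := one_le_mul_of_one_le_of_one_le hmR hkR
  have hl0 : 0 ≤ Real.logb 2 (S.m * S.k : ℝ) := Real.logb_nonneg one_lt_two hmk
  have hK : (0 : ℝ) ≤ K := K.cast_nonneg
  have hl1 : Real.logb 2 (S.m * S.k : ℝ) ≤ Real.logb 2 (n * γ) := by
    refine Real.logb_le_logb_of_le one_lt_two (by linarith) ?_
    refine le_trans ?_ h1
    exact mul_le_mul_of_nonneg_left (by linarith) (by linarith)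
  have heq : S.code.rate - γ
      = (Real.logb 2 (S.m * S.k : ℝ) + S.m * S.t - n * γ) / n := by
    rw [hrate]
    field_simp
  have heq2 : (4 + K) * (S.m / n) + Real.logb 2 (n * γ) / n
      = ((4 + K) * S.m + Real.logb 2 (n * γ)) / n := by ring
  rw [heq, heq2, abs_div, abs_of_pos hn']
  gcongr
  have : 0 ≤ S.m * (3 + K : ℝ) := by positivity
  rw [abs_le]
  constructor <;> nlinarith

open Classical in
theorem eventually_exists_error_lt [Fintype X] [Fintype Y] (W : DMC X Y) (hC : 0 < W.capacity)
    (K : ℕ) {ε : ℝ} (hε : 0 < ε) :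
    ∀ᶠ n : ℕ in Filter.atTop, ∃ S : RankedScheme X Y K n,
      |S.code.rate - W.capacity| + S.code.typeI W + S.code.typeII W < ε := by
  -- The tolerance is split into five: `|R - γ|`, `|γ - C|`, the transmission error once in each
  -- error type, and the collision term.
  obtain ⟨γ, hγ0, hγC⟩ := exists_between
    (max_lt (sub_lt_self W.capacity (show 0 < ε / 5 by positivity)) hC)
  have hγ : 0 < γ := (le_max_right _ _).trans_lt hγ0
  have hγ1 : W.capacity - ε / 5 < γ := (le_max_left _ _).trans_lt hγ0
  have ht1 : ∀ᶠ n : ℕ in Filter.atTop,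
      (4 + K) * ((n.sqrt : ℝ) / n) + Real.logb 2 (n * γ) / n < ε / 5 := by
    have := (tendsto_sqrt_div_self.const_mul (4 + K : ℝ)).add (tendsto_logb_mul_div_self hγ)
    rw [mul_zero, add_zero] at this
    exact this.eventually_lt_const (by positivity)
  have ht2 : ∀ᶠ n : ℕ in Filter.atTop, K * ((n * γ + 1) / 2 ^ n.sqrt) < ε / 5 := by
    have := (tendsto_hash_epsilon_bound γ).const_mul (K : ℝ)
    rw [mul_zero] at this
    exact this.eventually_lt_const (by positivity)
  filter_upwards [ht1, ht2, exists_hash_parameters hγ K, Filter.eventually_ge_atTop 1,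
    W.eventually_exists_code hC hγC (show 0 < ε / 5 by positivity)]
    with n hn1 hn2 ⟨hm, t, hp1, hp2⟩ hn hcode
  obtain ⟨h, hh⟩ := exists_hash_class (m := n.sqrt) (k := t + 1) (t := t) hm (by omega)
  have hcard : (Fintype.card (Fin ((2 ^ n.sqrt) ^ (t + 1 + 2)) × (Fin K → Fin (2 ^ n.sqrt))) : ℝ)
      ≤ (2 : ℝ) ^ (n * γ) := by
    have : Fintype.card (Fin ((2 ^ n.sqrt) ^ (t + 1 + 2)) × (Fin K → Fin (2 ^ n.sqrt)))
        = 2 ^ (n.sqrt * (t + 3 + K)) := by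
      simp only [Fintype.card_prod, Fintype.card_fin, Fintype.card_fun]
      rw [← pow_add, ← pow_mul]
    rw [this]
    push_cast
    rw [← Real.rpow_natCast]
    refine Real.rpow_le_rpow_of_exponent_le one_le_two ?_
    push_cast
    exact hp1
  have hne : Nonempty (Fin ((2 ^ n.sqrt) ^ (t + 1 + 2)) × (Fin K → Fin (2 ^ n.sqrt))) :=
    ⟨(⟨0, by positivity⟩, fun _ => ⟨0, by positivity⟩)⟩
  obtain ⟨f, g, hfg⟩ := hcode _ hcard
  let S : RankedScheme X Y K n := ⟨n.sqrt, hm, t + 1, t, rfl, h, hh, f, g⟩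
  refine ⟨S, ?_⟩
  have hS : ∀ s, ∑ y, (if S.g y = s then 0 else W.wordProb (S.f s) y) ≤ ε / 5 := fun s =>
    le_trans (le_of_eq (Finset.sum_congr rfl fun y _ => by congr)) (hfg s)
  have hI := S.typeI_le W (by positivity) hS
  have hII := S.typeII_le W (by positivity) hS
  have hr := (S.abs_rate_sub_le hn hp1 hp2).trans_lt hn1
  have hr' : |S.code.rate - W.capacity| ≤ |S.code.rate - γ| + |γ - W.capacity| :=
    abs_sub_le _ _ _
  have hr2 : |γ - W.capacity| < ε / 5 := by
    rw [abs_lt]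
    constructor <;> linarith
  have heps : (S.k : ℝ) / 2 ^ S.m + ((2 ^ S.m : ℝ) ^ S.t - 1) / (2 ^ S.m : ℝ) ^ S.k
      ≤ (n * γ + 1) / 2 ^ n.sqrt := by
    change ((t + 1 : ℕ) : ℝ) / 2 ^ n.sqrt + ((2 ^ n.sqrt : ℝ) ^ t - 1) / (2 ^ n.sqrt : ℝ) ^ (t + 1)
      ≤ _
    rw [add_div]
    have hmR : (1 : ℝ) ≤ n.sqrt := by exact_mod_cast hm
    have hK : (0 : ℝ) ≤ K := K.cast_nonneg
    have htR : (0 : ℝ) ≤ t := t.cast_nonneg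
    -- Here `k = t + 1 ≤ n γ` because `m ≥ 1`, and `(q ^ t - 1) / q ^ (t + 1) ≤ 1 / q`.
    gcongr ?_ / _ + ?_
    · push_cast
      nlinarith
    · rw [div_le_div_iff₀ (by positivity) (by positivity), pow_succ]
      nlinarith [show (0 : ℝ) < 2 ^ n.sqrt by positivity]
  have hKe := mul_le_mul_of_nonneg_left heps (K.cast_nonneg (α := ℝ))
  linarith

end RankedScheme

theorem corollary2 {X Y : Type*} [Fintype X] [Fintype Y] (W : DMC X Y) (hC : 0 < W.capacity)
    (K : ℕ) (hK : 1 ≤ K) :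
    ∃ S : (n : ℕ) → RankedScheme X Y K n,
      Filter.Tendsto (fun n => (S n).code.rate) Filter.atTop (nhds W.capacity) ∧
      Filter.Tendsto (fun n => (S n).code.typeI W) Filter.atTop (nhds 0) ∧
      Filter.Tendsto (fun n => (S n).code.typeII W) Filter.atTop (nhds 0) := by
  have hX : Nonempty X := by
    by_contra hX
    rw [not_nonempty_iff] at hX
    simp [DMC.capacity, DMC.mutualInfo] at hC
  have hne : ∀ n, Nonempty (RankedScheme X Y K n) := fun n => RankedScheme.nonempty
  have hI := fun n (S : RankedScheme X Y K n) => S.code.typeI_nonneg W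
  have hII := fun n (S : RankedScheme X Y K n) => S.code.typeII_nonneg W
  have hr := fun n (S : RankedScheme X Y K n) => abs_nonneg (S.code.rate - W.capacity)
  obtain ⟨S, hS⟩ := exists_tendsto_zero_of_eventually_lt
    (e := fun n (S : RankedScheme X Y K n) =>
      |S.code.rate - W.capacity| + S.code.typeI W + S.code.typeII W)
    (fun n S => add_nonneg (add_nonneg (hr n S) (hI n S)) (hII n S))
    (fun ε hε => RankedScheme.eventually_exists_error_lt W hC K hε)
  refine ⟨S, ?_, squeeze_zero (fun n => hI n _) (fun n => ?_) hS,
    squeeze_zero (fun n => hII n _) (fun n => ?_) hS⟩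
  · rw [tendsto_iff_dist_tendsto_zero]
    refine squeeze_zero (fun n => dist_nonneg) (fun n => ?_) hS
    rw [Real.dist_eq]
    linarith [hI n (S n), hII n (S n)]
  · linarith [hr n (S n), hII n (S n)]
  · linarith [hr n (S n), hI n (S n)]
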